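/- There is an absolute constant $c>0$ such that the following holds. Let $n\ge 1$, let $(a_{ij})$ be an $n\times n$ complex matrix with $\sum_{i,j=1}^n a_{ij}=0$ and $|a_{ij}|\le M$ for all $i,j$, and put $v=\frac1n\sum_{i,j=1}^n|a_{ij}|^2$. Let $\pi\in S_n$ be chosen uniformly at random and let $X=\sum_{i=1}^n a_{i\pi(i)}$. Then for all $t>0$, $$\mathbf P(|X|>t)\le 2\exp\left(\frac{-ct^2}{v+Mt}\right).$$ (If $v+Mt=0$, then $a=0$ and the left-hand side is $0$.) -/

import Mathlib

open MeasureTheory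

/-- The symmetric group `S_n` is finite; every subset is an event. -/
instance instMeasurableSpacePermFin (n : ℕ) : MeasurableSpace (Equiv.Perm (Fin n)) := ⊤

/-- The law of a uniformly random permutation of `n` points. -/
noncomputable def uniformPerm (n : ℕ) : Measure (Equiv.Perm (Fin n)) :=
  (PMF.uniformOfFintype (Equiv.Perm (Fin n))).toMeasure

/-- Hoeffding's statistic `X = ∑ i, a_{i π(i)}` of a complex matrix. -/
noncomputable def hoeffdingStat {n : ℕ} (a : Matrix (Fin n) (Fin n) ℂ)
    (π : Equiv.Perm (Fin n)) : ℂ :=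
  ∑ i, a i (π i)

/-- The variance proxy `v = (1/n) ∑ i j, |a_{ij}|²`. -/
noncomputable def hoeffdingVar {n : ℕ} (a : Matrix (Fin n) (Fin n) ℂ) : ℝ :=
  (1 / (n : ℝ)) * ∑ i, ∑ j, ‖a i j‖ ^ 2

/-! This is the method of exchangeable pairs. For real `a`, put m(θ) = ∑_π exp(θX). Composing π with
a transposition gives an exchangeable pair, and since the entries sum to zero, X − X' averages to
2X/n over all index pairs (i, j). Symmetrising bounds m' by θ times tilted sums of (X − X')²
(`card_mul_sum_mul_exp_le_sum_swap`). These involve ∑ a_{iπ(i)}², whose tilted mean is at most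
e^{4θM} v (`card_mul_sum_mul_exp_le`). Hence m' ≤ 16vθm while 4θM ≤ 1; integrating and applying
Markov gives the real case. Complex matrices split into real and imaginary parts. -/

/-! ### Transpositions and the tilted law of a single image -/

open Finset Equiv in
lemma sum_apply_sub_sum_apply_mul_swap {ι : Type*} [Fintype ι] [DecidableEq ι] (a : ι → ι → ℝ)
    (π : Perm ι) (i j : ι) :
    ∑ k, a k (π k) - ∑ k, a k ((π * swap i j) k) =
      a i (π i) + a j (π j) - a i (π j) - a j (π i) := by
  rcases eq_or_ne i j with rfl | hij
  · simp
  · rw [← sum_sub_distrib, Fintype.sum_eq_add i j hij]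
    · simp only [Perm.mul_apply, swap_apply_left, swap_apply_right]
      ring
    · rintro k ⟨hi, hj⟩
      simp [swap_apply_of_ne_of_ne hi hj]

open Finset Equiv in
/-- Exponential tilting by `θ X` changes the law of `π i` by at most a factor `exp (4 θ M)`. -/
lemma sum_ite_exp_le_of_apply_eq {ι : Type*} [Fintype ι] [DecidableEq ι] {a : ι → ι → ℝ} {M θ : ℝ}
    (hM : ∀ i j, |a i j| ≤ M) (hθ : 0 ≤ θ) (i j k : ι) :
    ∑ π : Perm ι, (if π i = j then Real.exp (θ * ∑ l, a l (π l)) else 0) ≤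
      Real.exp (4 * θ * M) *
        ∑ π : Perm ι, (if π i = k then Real.exp (θ * ∑ l, a l (π l)) else 0) := by
  -- Left multiplication by (j k) carries {π i = j} onto {π i = k} and alters X by four entries, so
  -- by at most 4M.
  rw [← Equiv.sum_comp (Equiv.mulLeft (swap j k))
    (fun π : Perm ι => if π i = k then Real.exp (θ * ∑ l, a l (π l)) else 0), mul_sum]
  refine sum_le_sum fun π _ => ?_
  by_cases h : π i = j
  · have hk : (swap j k * π) i = k := by simp [h]
    simp only [h, Equiv.coe_mulLeft, hk, if_true]
    rw [← Real.exp_add]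
    refine Real.exp_le_exp.2 ?_
    have h1 := sum_apply_sub_sum_apply_mul_swap a π (π.symm j) (π.symm k)
    rw [mul_swap_eq_swap_mul] at h1
    simp only [apply_symm_apply] at h1
    have e1 := abs_le.1 (hM (π.symm j) j)
    have e2 := abs_le.1 (hM (π.symm k) k)
    have e3 := abs_le.1 (hM (π.symm j) k)
    have e4 := abs_le.1 (hM (π.symm k) j)
    have : ∑ l, a l (π l) ≤ 4 * M + ∑ l, a l ((swap j k * π) l) := by linarith
    nlinarith [mul_le_mul_of_nonneg_left this hθ]
  · simp only [h, if_false]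
    positivity

-- Averaging the preceding comparison over k shows that each event π i = j has tilted probability at
-- most e^{4θM}/n.
open Finset Equiv in
lemma card_mul_sum_mul_exp_le {ι : Type*} [Fintype ι] [DecidableEq ι] {a g : ι → ι → ℝ} {M θ : ℝ}
    (hM : ∀ i j, |a i j| ≤ M) (hθ : 0 ≤ θ) (hg : ∀ i j, 0 ≤ g i j) :
    (Fintype.card ι : ℝ) *
        ∑ π : Perm ι, (∑ i, g i (π i)) * Real.exp (θ * ∑ l, a l (π l)) ≤
      Real.exp (4 * θ * M) * (∑ i, ∑ j, g i j) *
        ∑ π : Perm ι, Real.exp (θ * ∑ l, a l (π l)) := by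
  set w : Perm ι → ℝ := fun π => Real.exp (θ * ∑ l, a l (π l)) with hw
  have key : ∀ i j, (Fintype.card ι : ℝ) * ∑ π, (if π i = j then w π else 0) ≤
      Real.exp (4 * θ * M) * ∑ π, w π := by
    intro i j
    have h := sum_le_sum fun k (_ : k ∈ univ) => sum_ite_exp_le_of_apply_eq hM hθ i j k
    rw [sum_const, card_univ, nsmul_eq_mul, ← mul_sum, sum_comm] at h
    simpa using h
  have e : ∑ π, (∑ i, g i (π i)) * w π =
      ∑ i, ∑ j, g i j * ∑ π, (if π i = j then w π else 0) := by
    simp_rw [mul_sum, sum_mul]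
    rw [sum_comm]
    refine sum_congr rfl fun i _ => ?_
    rw [sum_comm]
    simp
  calc (Fintype.card ι : ℝ) * ∑ π, (∑ i, g i (π i)) * w π
      = ∑ i, ∑ j, g i j * ((Fintype.card ι : ℝ) * ∑ π, (if π i = j then w π else 0)) := by
        rw [e]
        simp_rw [mul_sum]
        simp only [mul_left_comm]
    _ ≤ ∑ i, ∑ j, g i j * (Real.exp (4 * θ * M) * ∑ π, w π) :=
        sum_le_sum fun i _ => sum_le_sum fun j _ => mul_le_mul_of_nonneg_left (key i j) (hg i j)
    _ = Real.exp (4 * θ * M) * (∑ i, ∑ j, g i j) * ∑ π, w π := by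
        simp_rw [← sum_mul]
        ring

/-! ### The exchangeable pair -/

/-- For y ≤ x this is the tangent line bound for exp at θx; the second exponential makes the bound
symmetric in x and y. -/
lemma sub_mul_exp_sub_exp_le {θ : ℝ} (hθ : 0 ≤ θ) (x y : ℝ) :
    (x - y) * (Real.exp (θ * x) - Real.exp (θ * y)) ≤
      θ * (x - y) ^ 2 * (Real.exp (θ * x) + Real.exp (θ * y)) := by
  wlog h : y ≤ x generalizing x y
  · have := this y x (le_of_not_ge h)
    nlinarith
  have h1 : Real.exp (θ * x) - Real.exp (θ * y) ≤ θ * (x - y) * Real.exp (θ * x) := by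
    have h2 := Real.add_one_le_exp (θ * y - θ * x)
    have h3 : Real.exp (θ * y) = Real.exp (θ * y - θ * x) * Real.exp (θ * x) := by
      rw [← Real.exp_add]; ring_nf
    rw [h3]
    nlinarith [Real.exp_pos (θ * x)]
  have h4 := mul_le_mul_of_nonneg_left h1 (sub_nonneg.2 h)
  have h5 : 0 ≤ θ * (x - y) ^ 2 * Real.exp (θ * y) := by positivity
  nlinarith

open Finset Equiv in
/-- The exchangeable pair bound for the derivative of the moment generating function of `X`. -/
lemma card_mul_sum_mul_exp_le_sum_swap {ι : Type*} [Fintype ι] [DecidableEq ι] {a : ι → ι → ℝ}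
    {θ : ℝ} (ha : ∑ i, ∑ j, a i j = 0) (hθ : 0 ≤ θ) :
    (Fintype.card ι : ℝ) * ∑ π : Perm ι, (∑ l, a l (π l)) * Real.exp (θ * ∑ l, a l (π l)) ≤
      4 * θ * ((Fintype.card ι : ℝ) *
        ∑ π : Perm ι, (∑ i, a i (π i) ^ 2) * Real.exp (θ * ∑ l, a l (π l)) +
        (∑ i, ∑ j, a i j ^ 2) * ∑ π : Perm ι, Real.exp (θ * ∑ l, a l (π l))) := by
  set X : Perm ι → ℝ := fun π => ∑ l, a l (π l) with hX
  set w : Perm ι → ℝ := fun π => Real.exp (θ * X π) with hw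
  have hrow : ∀ (f : ι → ι → ℝ) (π : Perm ι), ∑ i, ∑ j, f i (π j) = ∑ i, ∑ j, f i j :=
    fun f π => sum_congr rfl fun i _ => Equiv.sum_comp π (f i)
  have hΔ : ∀ (π : Perm ι) i j, X π - X (π * swap i j) =
      a i (π i) + a j (π j) - a i (π j) - a j (π i) := sum_apply_sub_sum_apply_mul_swap a
  have hsum : ∀ π : Perm ι, ∑ i, ∑ j, (X π - X (π * swap i j)) =
      2 * (Fintype.card ι : ℝ) * X π := by
    intro π
    simp_rw [hΔ, sum_sub_distrib, sum_add_distrib]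
    rw [hrow a π, sum_comm (f := fun i j => a j (π i)), hrow a π, ha]
    simp only [sum_const, card_univ, nsmul_eq_mul, ← mul_sum, hX]
    ring
  have hsq : ∀ π : Perm ι, ∑ i, ∑ j, (X π - X (π * swap i j)) ^ 2 ≤
      8 * ((Fintype.card ι : ℝ) * (∑ i, a i (π i) ^ 2) + ∑ i, ∑ j, a i j ^ 2) := by
    intro π
    have h1 : ∀ i j, (X π - X (π * swap i j)) ^ 2 ≤
        4 * (a i (π i) ^ 2 + a j (π j) ^ 2 + a i (π j) ^ 2 + a j (π i) ^ 2) := by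
      intro i j
      rw [hΔ]
      nlinarith [sq_nonneg (a i (π i) - a j (π j)), sq_nonneg (a i (π i) + a i (π j)),
        sq_nonneg (a i (π i) + a j (π i)), sq_nonneg (a j (π j) + a i (π j)),
        sq_nonneg (a j (π j) + a j (π i)), sq_nonneg (a i (π j) - a j (π i))]
    refine (sum_le_sum fun i _ => sum_le_sum fun j _ => h1 i j).trans_eq ?_
    simp_rw [← mul_sum, sum_add_distrib]
    rw [hrow (fun i j => a i j ^ 2) π, sum_comm (f := fun i j => a j (π i) ^ 2),
      hrow (fun i j => a i j ^ 2) π]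
    simp only [sum_const, card_univ, nsmul_eq_mul, ← mul_sum]
    ring
  have hreindex : ∀ i j (F : Perm ι → Perm ι → ℝ),
      ∑ π, F (π * swap i j) π = ∑ π, F π (π * swap i j) := by
    intro i j F
    rw [← Equiv.sum_comp (Equiv.mulRight (swap i j))]
    simp [mul_assoc]
  have hpair : ∀ i j, ∑ π, (X π - X (π * swap i j)) * w π ≤
      θ * ∑ π, (X π - X (π * swap i j)) ^ 2 * w π := by
    intro i j
    have h1 := hreindex i j fun σ τ => (X σ - X τ) * w τ
    have h2 := hreindex i j fun σ τ => (X σ - X τ) ^ 2 * w τ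
    have h3 := sum_le_sum fun π (_ : π ∈ univ) =>
      sub_mul_exp_sub_exp_le hθ (X π) (X (π * swap i j))
    -- Exchangeability: X − X' is antisymmetric under the swap, so w may be replaced by half of w −
    -- w'.
    have h4 : ∑ π, (X π - X (π * swap i j)) * (w π - w (π * swap i j)) =
        2 * ∑ π, (X π - X (π * swap i j)) * w π := by
      simp_rw [mul_sub, sum_sub_distrib]
      rw [← h1, ← sum_sub_distrib, mul_sum]
      exact sum_congr rfl fun π _ => by ring
    have h5 : ∑ π, θ * (X π - X (π * swap i j)) ^ 2 * (w π + w (π * swap i j)) =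
        2 * (θ * ∑ π, (X π - X (π * swap i j)) ^ 2 * w π) := by
      simp_rw [mul_assoc, ← mul_sum, mul_add, sum_add_distrib]
      rw [← h2, ← sum_add_distrib, mul_sum, mul_sum, mul_sum]
      exact sum_congr rfl fun π _ => by ring
    have h6 := h4.symm.trans_le (h3.trans_eq h5)
    linarith
  have e1 : ∑ i, ∑ j, ∑ π, (X π - X (π * swap i j)) * w π =
      2 * ((Fintype.card ι : ℝ) * ∑ π, X π * w π) := by
    simp_rw [sum_comm (s := (univ : Finset ι)) (t := (univ : Finset (Perm ι))), ← sum_mul, hsum,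
      mul_sum]
    exact sum_congr rfl fun π _ => by ring
  have e2 : ∑ i, ∑ j, ∑ π, (X π - X (π * swap i j)) ^ 2 * w π ≤
      8 * ((Fintype.card ι : ℝ) * ∑ π, (∑ i, a i (π i) ^ 2) * w π +
        (∑ i, ∑ j, a i j ^ 2) * ∑ π, w π) := by
    simp_rw [sum_comm (s := (univ : Finset ι)) (t := (univ : Finset (Perm ι))), ← sum_mul]
    refine (sum_le_sum fun π _ =>
      mul_le_mul_of_nonneg_right (hsq π) (Real.exp_pos _).le).trans_eq ?_
    simp_rw [mul_sum (s := (univ : Finset (Perm ι))), ← sum_add_distrib,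
      mul_sum (s := (univ : Finset (Perm ι)))]
    exact sum_congr rfl fun π _ => by ring
  have h := sum_le_sum fun i (_ : i ∈ univ) => sum_le_sum fun j (_ : j ∈ univ) => hpair i j
  simp_rw [← mul_sum] at h
  rw [e1] at h
  have := mul_le_mul_of_nonneg_left e2 hθ
  linarith

/-! ### From the differential inequality to real tails -/

/-- Grönwall: f(x) exp(−Kx²) is nonincreasing on [0, T]. -/
lemma le_mul_exp_of_deriv_le {f f' : ℝ → ℝ} {K T : ℝ} (hT : 0 ≤ T)
    (hf : ∀ x, HasDerivAt f (f' x) x) (hle : ∀ x, 0 ≤ x → x ≤ T → f' x ≤ 2 * K * x * f x) :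
    f T ≤ f 0 * Real.exp (K * T ^ 2) := by
  have hd : ∀ x, HasDerivAt (fun x => f x * Real.exp (-(K * x ^ 2)))
      ((f' x - 2 * K * x * f x) * Real.exp (-(K * x ^ 2))) x := by
    intro x
    have h1 : HasDerivAt (fun x : ℝ => -(K * x ^ 2)) (-(K * (2 * x))) x := by
      simpa using ((hasDerivAt_pow 2 x).const_mul K).fun_neg
    exact ((hf x).fun_mul h1.exp).congr_deriv (by ring)
  have hanti : AntitoneOn (fun x => f x * Real.exp (-(K * x ^ 2))) (Set.Icc 0 T) := by
    refine antitoneOn_of_deriv_nonpos (convex_Icc 0 T)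
      (fun x _ => (hd x).continuousAt.continuousWithinAt)
      (fun x _ => (hd x).differentiableAt.differentiableWithinAt) fun x hx => ?_
    rw [interior_Icc] at hx
    rw [(hd x).deriv]
    exact mul_nonpos_of_nonpos_of_nonneg (sub_nonpos.2 (hle x hx.1.le hx.2.le))
      (Real.exp_pos _).le
  have h := hanti (Set.left_mem_Icc.2 hT) (Set.right_mem_Icc.2 hT) hT
  simp only [Real.exp_neg, ← div_eq_mul_inv] at h
  rw [div_le_iff₀ (Real.exp_pos _)] at h
  simpa using h

open Finset Equiv in
/-- Sub-Gaussian bound for the moment generating function of Hoeffding's statistic. -/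
lemma sum_exp_le_card_mul_exp {ι : Type*} [Fintype ι] [DecidableEq ι] [Nonempty ι]
    {a : ι → ι → ℝ} {M θ v : ℝ} (ha : ∑ i, ∑ j, a i j = 0) (hM : ∀ i j, |a i j| ≤ M)
    (hv : ∑ i, ∑ j, a i j ^ 2 ≤ Fintype.card ι * v) (hθ : 0 ≤ θ) (hθM : 4 * θ * M ≤ 1) :
    ∑ π : Perm ι, Real.exp (θ * ∑ l, a l (π l)) ≤
      Fintype.card (Perm ι) * Real.exp (8 * v * θ ^ 2) := by
  have hn : (0 : ℝ) < Fintype.card ι := by exact_mod_cast Fintype.card_pos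
  have hM0 : 0 ≤ M := (abs_nonneg _).trans (hM (Classical.arbitrary ι) (Classical.arbitrary ι))
  have hd : ∀ x : ℝ, HasDerivAt (fun x => ∑ π : Perm ι, Real.exp (x * ∑ l, a l (π l)))
      (∑ π : Perm ι, (∑ l, a l (π l)) * Real.exp (x * ∑ l, a l (π l))) x := by
    intro x
    refine HasDerivAt.fun_sum fun π _ => ?_
    simpa [mul_comm] using ((hasDerivAt_id x).mul_const (∑ l, a l (π l))).exp
  have h := le_mul_exp_of_deriv_le (K := 8 * v) hθ hd fun x hx0 hxθ => ?_
  · simpa using h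
  have h1 := card_mul_sum_mul_exp_le_sum_swap ha hx0
  have h2 := card_mul_sum_mul_exp_le (g := fun i j => a i j ^ 2) hM hx0 fun i j => sq_nonneg _
  have h3 : Real.exp (4 * x * M) ≤ 3 := by
    refine (Real.exp_le_exp.2 (?_ : 4 * x * M ≤ 1)).trans Real.exp_one_lt_three.le
    nlinarith
  set S := ∑ π : Perm ι, Real.exp (x * ∑ l, a l (π l))
  have hS : 0 ≤ S := sum_nonneg fun π _ => (Real.exp_pos _).le
  set V := ∑ i, ∑ j, a i j ^ 2
  have hV : 0 ≤ V := sum_nonneg fun i _ => sum_nonneg fun j _ => sq_nonneg _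
  have h4 : Real.exp (4 * x * M) * V * S ≤ 3 * V * S := by gcongr
  have h5 : V * S ≤ Fintype.card ι * v * S := by gcongr
  have h6 := h1.trans (mul_le_mul_of_nonneg_left
    (show _ ≤ 4 * (Fintype.card ι * v * S) by linarith) (by positivity : 0 ≤ 4 * x))
  refine le_of_mul_le_mul_left ?_ hn
  linarith

open Finset Equiv in
/-- Bernstein's inequality for the upper tail of Hoeffding's statistic of a real matrix. -/
lemma card_filter_lt_le_card_mul_exp {ι : Type*} [Fintype ι] [DecidableEq ι] [Nonempty ι]
    {a : ι → ι → ℝ} {M t v : ℝ} (ha : ∑ i, ∑ j, a i j = 0) (hM : ∀ i j, |a i j| ≤ M)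
    (hv : ∑ i, ∑ j, a i j ^ 2 ≤ Fintype.card ι * v) (hM0 : 0 < M) (ht : 0 < t) :
    (#{π : Perm ι | t < ∑ l, a l (π l)} : ℝ) ≤
      Fintype.card (Perm ι) * Real.exp (-(t ^ 2) / (32 * (v + M * t))) := by
  have hn : (0 : ℝ) < Fintype.card ι := by exact_mod_cast Fintype.card_pos
  have hv0 : 0 ≤ v := by
    have : 0 ≤ ∑ i, ∑ j, a i j ^ 2 := sum_nonneg fun i _ => sum_nonneg fun j _ => sq_nonneg _
    exact nonneg_of_mul_nonneg_right (this.trans hv) hn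
  have hMt : 0 < M * t := mul_pos hM0 ht
  -- With θ = t/D one has 4θM ≤ 1/4 and 8vθ² ≤ θt/2, so the Markov exponent is at most −θt/2.
  set D := 16 * (v + M * t) with hD
  have hDpos : 0 < D := by positivity
  set θ := t / D with hθ
  have hθD : θ * D = t := div_mul_cancel₀ _ hDpos.ne'
  have hθ0 : 0 < θ := by positivity
  have hθM : 4 * θ * M ≤ 1 := by
    have h1 : 4 * θ * M = 4 * (M * t) / D := by rw [hθ]; ring
    rw [h1, div_le_one hDpos]
    linarith
  have hmgf := sum_exp_le_card_mul_exp ha hM hv hθ0.le hθM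
  have hmarkov : (#{π : Perm ι | t < ∑ l, a l (π l)} : ℝ) * Real.exp (θ * t) ≤
      ∑ π : Perm ι, Real.exp (θ * ∑ l, a l (π l)) := by
    rw [← nsmul_eq_mul]
    refine (card_nsmul_le_sum _ (fun π : Perm ι => Real.exp (θ * ∑ l, a l (π l))) _ ?_).trans
      (sum_le_sum_of_subset_of_nonneg (filter_subset _ _) fun _ _ _ => (Real.exp_pos _).le)
    intro π hπ
    have := (mem_filter.1 hπ).2
    exact Real.exp_le_exp.2 (mul_le_mul_of_nonneg_left this.le hθ0.le)
  rw [← le_div_iff₀ (Real.exp_pos _)] at hmarkov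
  refine hmarkov.trans ((div_le_div_of_nonneg_right hmgf (Real.exp_pos _).le).trans ?_)
  rw [mul_div_assoc, ← Real.exp_sub]
  refine mul_le_mul_of_nonneg_left (Real.exp_le_exp.2 ?_) (Nat.cast_nonneg _)
  have h1 : -(t ^ 2) / (32 * (v + M * t)) = -(θ * t) / 2 := by
    rw [hθ, show 32 * (v + M * t) = 2 * D by rw [hD]; ring]
    field_simp
  rw [h1]
  have h2 : 8 * v * θ ^ 2 ≤ θ * (θ * D) / 2 := by
    have : 0 ≤ θ ^ 2 * (M * t) := by positivity
    rw [hD]; nlinarith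
  rw [hθD] at h2
  linarith

open Finset Equiv in
/-- Bernstein's inequality for Hoeffding's statistic of a real matrix. -/
lemma card_filter_lt_abs_le_card_mul_exp {ι : Type*} [Fintype ι] [DecidableEq ι] [Nonempty ι]
    {a : ι → ι → ℝ} {M t v : ℝ} (ha : ∑ i, ∑ j, a i j = 0) (hM : ∀ i j, |a i j| ≤ M)
    (hv : ∑ i, ∑ j, a i j ^ 2 ≤ Fintype.card ι * v) (hM0 : 0 < M) (ht : 0 < t) :
    (#{π : Perm ι | t < |∑ l, a l (π l)|} : ℝ) ≤
      Fintype.card (Perm ι) * (2 * Real.exp (-(t ^ 2) / (32 * (v + M * t)))) := by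
  have h1 := card_filter_lt_le_card_mul_exp ha hM hv hM0 ht
  have h2 := card_filter_lt_le_card_mul_exp (a := fun i j => -a i j) (v := v)
    (by simp [sum_neg_distrib, ha]) (by simpa using hM) (by simpa using hv) hM0 ht
  have h3 : #{π : Perm ι | t < |∑ l, a l (π l)|} ≤
      #{π : Perm ι | t < ∑ l, a l (π l)} + #{π : Perm ι | t < ∑ l, -a l (π l)} := by
    refine (card_le_card fun π hπ => ?_).trans (card_union_le _ _)
    simpa [lt_abs, sum_neg_distrib] using hπ
  have h4 : (#{π : Perm ι | t < |∑ l, a l (π l)|} : ℝ) ≤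
      #{π : Perm ι | t < ∑ l, a l (π l)} + #{π : Perm ι | t < ∑ l, -a l (π l)} := by
    exact_mod_cast h3
  linarith

/-! ### Uniform measure and complex matrices -/

lemma uniformPerm_real_eq (n : ℕ) (p : Equiv.Perm (Fin n) → Prop) [DecidablePred p] :
    (uniformPerm n).real {π | p π} =
      (Finset.card {π | p π} : ℝ) / Fintype.card (Equiv.Perm (Fin n)) := by
  rw [Measure.real, uniformPerm, PMF.toMeasure_uniformOfFintype_apply _ MeasurableSpace.measurableSet_top,
    ENNReal.toReal_div, ENNReal.toReal_natCast, ENNReal.toReal_natCast, Fintype.card_subtype]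
  rfl

/-- The union bound over both parts costs a prefactor 4. As p ≤ 1, min(1, 4y²) ≤ 2y with y = e^x
restores 2 by halving the exponent. -/
lemma le_two_mul_exp_half_of_le_four_mul_exp {p x : ℝ} (hp1 : p ≤ 1)
    (hp : p ≤ 4 * Real.exp (2 * x)) : p ≤ 2 * Real.exp x := by
  rw [two_mul x, Real.exp_add] at hp
  nlinarith [Real.exp_pos x, mul_self_nonneg (2 * Real.exp x - 1)]

theorem mainTheorem5 :
    ∃ c : ℝ, 0 < c ∧
      ∀ (n : ℕ) (a : Matrix (Fin n) (Fin n) ℂ) (M : ℝ),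
        (∑ i, ∑ j, a i j = 0) →
        (∀ i j, ‖a i j‖ ≤ M) →
        ∀ t : ℝ, 0 < t →
          (uniformPerm n).real {π | t < ‖hoeffdingStat a π‖} ≤
            2 * Real.exp (-(c * t ^ 2) / (hoeffdingVar a + M * t)) := by
  classical
  -- 256 = 32 · 4 · 2: the real case, t/2 in place of t, and the halved exponent.
  refine ⟨1 / 256, by norm_num, fun n a M ha hM t ht => ?_⟩
  rw [uniformPerm_real_eq]
  -- The zero case absorbs n = 0 and M ≤ 0; otherwise a nonzero entry forces n > 0 and M > 0.
  by_cases h0 : ∀ i j, a i j = 0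
  · have : ∀ π, ¬ t < ‖hoeffdingStat a π‖ := fun π => by simp [hoeffdingStat, h0, ht.le]
    simp only [this, Finset.filter_false, Finset.card_empty, Nat.cast_zero, zero_div]
    positivity
  push Not at h0
  obtain ⟨i₀, j₀, hij⟩ := h0
  have : Nonempty (Fin n) := ⟨i₀⟩
  have hM0 : 0 < M := (norm_pos_iff.2 hij).trans_le (hM i₀ j₀)
  have hn : (0 : ℝ) < n := by exact_mod_cast Fin.pos i₀
  have hv : ∑ i, ∑ j, ‖a i j‖ ^ 2 = Fintype.card (Fin n) * hoeffdingVar a := by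
    rw [hoeffdingVar, Fintype.card_fin, ← mul_assoc, mul_one_div_cancel hn.ne', one_mul]
  have hN : (0 : ℝ) < Fintype.card (Equiv.Perm (Fin n)) := by exact_mod_cast Fintype.card_pos
  have hre := card_filter_lt_abs_le_card_mul_exp (a := fun i j => (a i j).re) (t := t / 2)
    (v := hoeffdingVar a) (by simpa using congrArg Complex.re ha)
    (fun i j => (Complex.abs_re_le_norm _).trans (hM i j))
    (hv ▸ Finset.sum_le_sum fun i _ => Finset.sum_le_sum fun j _ =>
      sq_le_sq' (by linarith [(abs_le.1 (Complex.abs_re_le_norm (a i j))).1])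
        (Complex.re_le_norm _)) hM0 (half_pos ht)
  have him := card_filter_lt_abs_le_card_mul_exp (a := fun i j => (a i j).im) (t := t / 2)
    (v := hoeffdingVar a) (by simpa using congrArg Complex.im ha)
    (fun i j => (Complex.abs_im_le_norm _).trans (hM i j))
    (hv ▸ Finset.sum_le_sum fun i _ => Finset.sum_le_sum fun j _ =>
      sq_le_sq' (by linarith [(abs_le.1 (Complex.abs_im_le_norm (a i j))).1])
        (Complex.im_le_norm _)) hM0 (half_pos ht)
  have hv0 : 0 ≤ hoeffdingVar a := by rw [hoeffdingVar]; positivity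
  have hMt : 0 < M * t := mul_pos hM0 ht
  have hexp : Real.exp (-((t / 2) ^ 2) / (32 * (hoeffdingVar a + M * (t / 2)))) ≤
      Real.exp (2 * (-(1 / 256 * t ^ 2) / (hoeffdingVar a + M * t))) := by
    refine Real.exp_le_exp.2 ?_
    rw [show 2 * (-(1 / 256 * t ^ 2) / (hoeffdingVar a + M * t)) =
      -((t / 2) ^ 2) / (32 * (hoeffdingVar a + M * t)) by field_simp; norm_num,
      neg_div, neg_div, neg_le_neg_iff]
    gcongr
    linarith
  have hunion : ∀ π, t < ‖hoeffdingStat a π‖ →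
      t / 2 < |∑ l, (a l (π l)).re| ∨ t / 2 < |∑ l, (a l (π l)).im| := by
    intro π hπ
    have h1 := Complex.norm_le_abs_re_add_abs_im (hoeffdingStat a π)
    simp only [hoeffdingStat, Complex.re_sum, Complex.im_sum] at h1 hπ
    by_contra! h2
    linarith [h2.1, h2.2]
  have hcard : (Finset.card {π | t < ‖hoeffdingStat a π‖} : ℝ) ≤
      Finset.card {π : Equiv.Perm (Fin n) | t / 2 < |∑ l, (a l (π l)).re|} +
        Finset.card {π : Equiv.Perm (Fin n) | t / 2 < |∑ l, (a l (π l)).im|} := by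
    norm_cast
    refine (Finset.card_le_card fun π hπ => ?_).trans (Finset.card_union_le _ _)
    simpa using hunion π (Finset.mem_filter.1 hπ).2
  refine le_two_mul_exp_half_of_le_four_mul_exp ?_ ?_
  · rw [div_le_one hN]
    exact_mod_cast Finset.card_le_univ _
  · rw [div_le_iff₀ hN]
    have := mul_le_mul_of_nonneg_left hexp hN.le
    linarith
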